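/- Let $d\ge 2$, and let $G\in\mathbb{R}^{d\times d}$ be symmetric positive semidefinite with eigenvalues $\lambda_1\ge\lambda_2\ge\cdots\ge\lambda_d\ge 0$ and a spectral decomposition $G=U\Lambda U^\top$, where $U$ is orthogonal and $\Lambda=\mathrm{diag}(\lambda_1,\dots,\lambda_d)$. Let $s$ be a random vector uniformly distributed on the unit sphere $S^{d-1}=\{x\in\mathbb{R}^d:\|x\|_2=1\}$, let $m>0$, and put $c=m\,s$ and $Y=U^\top s$. Then: (i) $c^\top G c=m^2\sum_{i=1}^d\lambda_i Y_i^2$; (ii) $Y$ is also uniformly distributed on $S^{d-1}$, and $Y_1^2\sim\mathrm{Beta}\!\left(\tfrac12,\tfrac{d-1}{2}\right)$; (iii) almost surely (namely wherever $\|s\|_2=1$), $\|c\|_2=m$ and $$m^2\lambda_1Y_1^2\;\le\;c^\top Gc\;\le\;m^2\bigl(\lambda_1Y_1^2+\lambda_2(1-Y_1^2)\bigr);$$ (iv) if $\lambda_1>0$, then the law of $\dfrac{c^\top Gc}{\lambda_1\|c\|_2^2}$ is close to that of $Z\sim\mathrm{Beta}\!\left(\tfrac12,\tfrac{d-1}{2}\right)$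 when $\lambda_2/\lambda_1$ is small: the Lévy–Prokhorov distance between the two laws is at most $\lambda_2/\lambda_1$. -/

import Mathlib

open MeasureTheory ProbabilityTheory Matrix

/-- The uniform probability measure on the unit sphere of `ℝ^d`, as a measure on the ambient
Euclidean space: the rotation-invariant surface measure of the sphere, normalised to total mass
one and pushed forward along the inclusion of the sphere. -/
noncomputable def uniformSphere (d : ℕ) : Measure (EuclideanSpace ℝ (Fin d)) :=
  ((volume : Measure (EuclideanSpace ℝ (Fin d))).toSphere Set.univ)⁻¹ •
    ((volume : Measure (EuclideanSpace ℝ (Fin d))).toSphere).map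
      (Subtype.val : Metric.sphere (0 : EuclideanSpace ℝ (Fin d)) 1 → EuclideanSpace ℝ (Fin d))

/-- The quadratic form `xᵀ G x` on `ℝ^d`. -/
noncomputable def quadForm {d : ℕ} (G : Matrix (Fin d) (Fin d) ℝ)
    (x : EuclideanSpace ℝ (Fin d)) : ℝ :=
  x.ofLp ⬝ᵥ (G *ᵥ x.ofLp)

open scoped ENNReal Pointwise

/-! The quadratic form is diagonal in the coordinates `Y`, and rotation invariance keeps `Y`
uniform. The sandwich holds because the eigenvalues after the first lie in `[0, λ₂]` and carry total
weight `1 - Y₁²`. It puts the normalised form within `λ₂/λ₁` of `Y₁²` on the same probability space,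
and such a coupling bounds the Lévy–Prokhorov distance. The analytic core is the Beta law
(`map_sq_uniformSphere`). Sampling the sphere by normalising a point `(t, y)` of the unit ball turns
`Y₁²` into `u = t²/(t² + |y|²)`. Substituting `u` for `t` and applying Fubini and a dilation in `y`
factors the integral into a constant times the Beta integral (`lintegral_lintegral_ball_ratio`). -/

/-! ### The uniform law on the sphere and its rotation invariance. -/

theorem isProbabilityMeasure_uniformSphere (d : ℕ) [NeZero d] :
    IsProbabilityMeasure (uniformSphere d) := by
  have : Nontrivial (EuclideanSpace ℝ (Fin d)) := inferInstance
  refine ⟨?_⟩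
  rw [uniformSphere, Measure.smul_apply, Measure.map_apply measurable_subtype_coe .univ,
    Set.preimage_univ, smul_eq_mul]
  exact ENNReal.inv_mul_cancel (Measure.measure_univ_ne_zero.mpr (Measure.toSphere_ne_zero _))
    (measure_ne_top _ _)

theorem ae_norm_eq_one_uniformSphere (d : ℕ) : ∀ᵐ x ∂uniformSphere d, ‖x‖ = 1 := by
  refine Measure.ae_smul_measure ?_ _
  rw [ae_map_iff measurable_subtype_coe.aemeasurable
    (measurableSet_eq_fun measurable_norm measurable_const)]
  exact .of_forall fun x => by simp

/-- The uniform law on the sphere is the law of `x / ‖x‖` for `x` uniform in the unit ball. -/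
theorem uniformSphere_eq_map_normalize (d : ℕ) [NeZero d] :
    uniformSphere d =
      (((volume : Measure (EuclideanSpace ℝ (Fin d))).toSphere Set.univ)⁻¹ * d) •
        ((volume : Measure (EuclideanSpace ℝ (Fin d))).restrict (Metric.ball 0 1)).map
          (fun x => ‖x‖⁻¹ • x) := by
  have : Nontrivial (EuclideanSpace ℝ (Fin d)) := inferInstance
  have hm : Measurable fun x : EuclideanSpace ℝ (Fin d) => ‖x‖⁻¹ • x := by fun_prop
  ext A hA
  rw [uniformSphere, Measure.smul_apply, Measure.smul_apply,
    Measure.map_apply measurable_subtype_coe hA, Measure.map_apply hm hA,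
    Measure.toSphere_apply' _ (measurable_subtype_coe hA), Measure.restrict_apply (hm hA),
    finrank_euclideanSpace, Fintype.card_fin, smul_eq_mul, smul_eq_mul, mul_assoc]
  congr 2
  -- `toSphere` measures `A` by the volume of the open cone over it, which omits the origin; a point
  -- is null.
  have : Set.Ioo (0 : ℝ) 1 •
      ((↑) '' ((↑) ⁻¹' A : Set (Metric.sphere (0 : EuclideanSpace ℝ (Fin d)) 1)))
      = ((fun x : EuclideanSpace ℝ (Fin d) => ‖x‖⁻¹ • x) ⁻¹' A ∩ Metric.ball 0 1) \ {0} := by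
    ext x
    simp only [Set.mem_smul, Set.mem_image, Set.mem_preimage, Subtype.exists, Set.mem_sdiff,
      Set.mem_inter_iff, mem_ball_zero_iff, Set.mem_singleton_iff, mem_sphere_zero_iff_norm]
    constructor
    · rintro ⟨r, hr, _, ⟨y, hy, hyA, rfl⟩, rfl⟩
      have hy0 : y ≠ 0 := by rintro rfl; simp at hy
      simp only [norm_smul, hy, Real.norm_eq_abs, abs_of_pos hr.1, mul_one, smul_smul,
        inv_mul_cancel₀ hr.1.ne', one_smul]
      exact ⟨⟨hyA, hr.2⟩, smul_ne_zero hr.1.ne' hy0⟩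
    · rintro ⟨⟨hxA, hx1⟩, hx0⟩
      have hx : 0 < ‖x‖ := norm_pos_iff.mpr hx0
      exact ⟨‖x‖, ⟨hx, hx1⟩, _, ⟨‖x‖⁻¹ • x, by simp [norm_smul, hx.ne'], hxA, rfl⟩, by
        simp [smul_smul, hx.ne']⟩
  rw [this, measure_sdiff_null (measure_singleton _)]

/-- A linear isometry preserves volume and the unit ball, and commutes with `x ↦ ‖x‖⁻¹ • x`. -/
theorem measurePreserving_uniformSphere (d : ℕ) [NeZero d]
    (L : EuclideanSpace ℝ (Fin d) ≃ₗᵢ[ℝ] EuclideanSpace ℝ (Fin d)) :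
    MeasurePreserving L (uniformSphere d) (uniformSphere d) := by
  have hL : Measurable L := L.continuous.measurable
  refine ⟨hL, ?_⟩
  have hm : Measurable fun x : EuclideanSpace ℝ (Fin d) => ‖x‖⁻¹ • x := by fun_prop
  have hr := L.measurePreserving.restrict_preimage
    (s := Metric.ball (0 : EuclideanSpace ℝ (Fin d)) 1) measurableSet_ball
  have hb : L ⁻¹' Metric.ball (0 : EuclideanSpace ℝ (Fin d)) 1 = Metric.ball 0 1 := by
    ext x; simp
  rw [hb] at hr
  rw [uniformSphere_eq_map_normalize, Measure.map_smul, Measure.map_map hL hm]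
  conv_rhs => rw [← hr.map_eq, Measure.map_map hm hL]
  congr 2
  ext1 x
  simp

/-! ### Lévy–Prokhorov distance from a coupling. -/

theorem levyProkhorovEDist_map_le {Ω : Type*} [MeasurableSpace Ω] (P : Measure Ω)
    {X B : Ω → ℝ} (hX : AEMeasurable X P) (hB : AEMeasurable B P) {ε : ℝ}
    (h : ∀ᵐ ω ∂P, |X ω - B ω| ≤ ε) :
    levyProkhorovEDist (P.map X) (P.map B) ≤ ENNReal.ofReal ε := by
  have key : ∀ {X B : Ω → ℝ}, AEMeasurable X P → AEMeasurable B P →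
      (∀ᵐ ω ∂P, |X ω - B ω| ≤ ε) → ∀ (δ : ℝ≥0∞) (S : Set ℝ), ENNReal.ofReal ε < δ → δ < ∞ →
      MeasurableSet S → P.map X S ≤ P.map B (Metric.thickening δ.toReal S) + δ := by
    intro X B hX hB h δ S hδ hδt hS
    -- The closeness is almost sure, so thickening alone suffices and the additive `δ` is dropped.
    refine le_add_right ?_
    rw [Measure.map_apply_of_aemeasurable hX hS,
      Measure.map_apply_of_aemeasurable hB Metric.isOpen_thickening.measurableSet]
    refine measure_mono_ae ?_
    filter_upwards [h] with ω hω hωS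
    refine Metric.mem_thickening_iff.mpr ⟨X ω, hωS, ?_⟩
    rw [dist_comm, Real.dist_eq]
    refine hω.trans_lt ?_
    by_contra! hcon
    exact absurd (ENNReal.ofReal_le_ofReal hcon) (by
      rw [ENNReal.ofReal_toReal hδt.ne]; exact not_le.mpr hδ)
  refine levyProkhorovEDist_le_of_forall _ _ _ fun δ S hδ hδt hS =>
    ⟨key hX hB h δ S hδ hδt hS, key hB hX ?_ δ S hδ hδt hS⟩
  filter_upwards [h] with ω hω
  rwa [abs_sub_comm]

/-! ### Integrals behind the Beta law. -/

theorem lintegral_comp_sq (g : ℝ → ℝ≥0∞) :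
    ∫⁻ t : ℝ, g (t ^ 2) = 2 * ∫⁻ t in Set.Ioi (0 : ℝ), g (t ^ 2) := by
  have h1 : ∫⁻ t in Set.Iic (0 : ℝ), g (t ^ 2) = ∫⁻ t in Set.Ioi (0 : ℝ), g (t ^ 2) := by
    have := (Measure.measurePreserving_neg (volume : Measure ℝ)).setLIntegral_comp_preimage_emb
      (MeasurableEquiv.neg ℝ).measurableEmbedding (fun t => g (t ^ 2)) (Set.Iic 0)
    rw [← this]
    simp only [neg_sq]
    rw [show (Neg.neg ⁻¹' Set.Iic (0 : ℝ)) = Set.Ici 0 by ext; simp]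
    exact setLIntegral_congr Ioi_ae_eq_Ici.symm
  rw [← lintegral_add_compl _ (measurableSet_Iic (a := (0 : ℝ))), Set.compl_Iic, h1, two_mul]

/-- Substituting `t = √(q u / (1 - u))`, that is `u = t² / (t² + q)`. -/
theorem lintegral_Ioi_eq_lintegral_Ioo_ratio {q : ℝ} (hq : 0 < q) (h : ℝ → ℝ≥0∞) :
    ∫⁻ t in Set.Ioi (0 : ℝ), h (t ^ 2) =
      ∫⁻ u in Set.Ioo (0 : ℝ) 1,
        ENNReal.ofReal (1 / (2 * √(u / (1 - u))) / (1 - u) ^ 2) *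
          (ENNReal.ofReal (√q) * h (q * (u / (1 - u)))) := by
  have hdiv : ∀ u ∈ Set.Ioo (0 : ℝ) 1, 0 < u / (1 - u) := fun u hu =>
    div_pos hu.1 (by linarith [hu.2])
  have himg : (fun u : ℝ => √q * √(u / (1 - u))) '' Set.Ioo 0 1 = Set.Ioi 0 := by
    ext t
    constructor
    · rintro ⟨u, hu, rfl⟩
      have := hdiv u hu
      exact mul_pos (Real.sqrt_pos.mpr hq) (Real.sqrt_pos.mpr this)
    · intro ht
      have ht : 0 < t := ht
      refine ⟨t ^ 2 / (t ^ 2 + q), ⟨by positivity, ?_⟩, ?_⟩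
      · rw [div_lt_one (by positivity)]; linarith
      · have : t ^ 2 / (t ^ 2 + q) / (1 - t ^ 2 / (t ^ 2 + q)) = t ^ 2 / q := by
          have : t ^ 2 + q ≠ 0 := by positivity
          have h2 : 1 - t ^ 2 / (t ^ 2 + q) = q / (t ^ 2 + q) := by field_simp; ring
          rw [h2]; field_simp
        simp only [this]
        rw [← Real.sqrt_mul hq.le, mul_div_cancel₀ _ hq.ne', Real.sqrt_sq ht.le]
  have hder : ∀ u ∈ Set.Ioo (0 : ℝ) 1, HasDerivWithinAt (fun u : ℝ => √q * √(u / (1 - u)))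
      (√q * (1 / (2 * √(u / (1 - u))) / (1 - u) ^ 2)) (Set.Ioo 0 1) u := by
    intro u hu
    have h1 : (1 - u) ≠ 0 := by linarith [hu.2]
    have hd : HasDerivAt (fun u : ℝ => u / (1 - u)) (1 / (1 - u) ^ 2) u := by
      refine ((hasDerivAt_id u).div ((hasDerivAt_id u).const_sub 1) h1).congr_deriv ?_
      simp
    refine ((hd.sqrt (hdiv u hu).ne').const_mul (√q)).hasDerivWithinAt.congr_deriv ?_
    ring
  have hinj : Set.InjOn (fun u : ℝ => √q * √(u / (1 - u))) (Set.Ioo 0 1) := by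
    intro u hu v hv huv
    have h1 := mul_left_cancel₀ (Real.sqrt_pos.mpr hq).ne' huv
    rw [Real.sqrt_inj (hdiv u hu).le (hdiv v hv).le,
      div_eq_div_iff (by linarith [hu.2]) (by linarith [hv.2])] at h1
    linarith
  rw [← himg, lintegral_image_eq_lintegral_abs_deriv_mul measurableSet_Ioo hder hinj]
  refine setLIntegral_congr_fun measurableSet_Ioo fun u hu => ?_
  have := hdiv u hu
  rw [abs_of_nonneg (by positivity), mul_comm (√q), ENNReal.ofReal_mul (by positivity), mul_assoc,
    mul_pow, Real.sq_sqrt hq.le, Real.sq_sqrt this.le]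

/-- Behaviour of the truncated first moment of the norm under the dilation by `√a`. -/
theorem lintegral_sqrt_sum_sq_indicator_scale (k : ℕ) {a : ℝ} (ha : 0 < a) :
    ∫⁻ y : Fin k → ℝ, ENNReal.ofReal (√(∑ i, y i ^ 2)) *
        Set.indicator (Set.Iio a) 1 (∑ i, y i ^ 2) =
      ENNReal.ofReal (√a ^ (k + 1)) *
        ∫⁻ y : Fin k → ℝ, ENNReal.ofReal (√(∑ i, y i ^ 2)) *
          Set.indicator (Set.Iio 1) 1 (∑ i, y i ^ 2) := by
  have hs : 0 < √a := Real.sqrt_pos.mpr ha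
  have hmap := Measure.map_addHaar_smul (volume : Measure (Fin k → ℝ)) hs.ne'
  have hmeas : Measurable fun y : Fin k → ℝ => ENNReal.ofReal (√(∑ i, y i ^ 2)) *
        Set.indicator (Set.Iio a) (1 : ℝ → ℝ≥0∞) (∑ i, y i ^ 2) := by
    refine Measurable.mul (by fun_prop) ?_
    exact (measurable_one.indicator measurableSet_Iio).comp (by fun_prop)
  have h2 := lintegral_map (μ := (volume : Measure (Fin k → ℝ))) hmeas
    (measurable_const_smul (√a))
  rw [hmap, lintegral_smul_measure, smul_eq_mul] at h2
  have h3 : ∀ y : Fin k → ℝ, ∑ i, (√a • y) i ^ 2 = a * ∑ i, y i ^ 2 := by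
    intro y
    simp [mul_pow, Real.sq_sqrt ha.le, Finset.mul_sum]
  simp only [h3] at h2
  have h4 : ∀ x : ℝ, Set.indicator (Set.Iio a) (1 : ℝ → ℝ≥0∞) (a * x) =
      Set.indicator (Set.Iio 1) 1 x := by
    intro x
    have : a * x < a ↔ x < 1 := by
      constructor <;> intro h <;> nlinarith
    simp [Set.indicator_apply, this]
  simp only [h4, Real.sqrt_mul ha.le, ENNReal.ofReal_mul hs.le, mul_assoc] at h2
  rw [lintegral_const_mul' _ _ ENNReal.ofReal_ne_top] at h2
  -- Of the `k + 1` factors `√a`, the volume contributes `k` and the norm in the integrand one.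
  rw [pow_succ, ENNReal.ofReal_mul (by positivity), mul_assoc, ← h2, ← mul_assoc,
    ← ENNReal.ofReal_mul (by positivity), Module.finrank_fin_fun, abs_of_pos (by positivity),
    mul_inv_cancel₀ (by positivity), ENNReal.ofReal_one, one_mul]

theorem betaMeasure_lintegral (a b : ℝ) {f : ℝ → ℝ≥0∞} (hf : Measurable f) :
    ∫⁻ u, f u ∂betaMeasure a b =
      ENNReal.ofReal (1 / beta a b) * ∫⁻ u in Set.Ioo (0 : ℝ) 1,
        ENNReal.ofReal (u ^ (a - 1) * (1 - u) ^ (b - 1)) * f u := by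
  have hpdf : betaPDF a b = fun u => (Set.Ioo (0 : ℝ) 1).indicator
      (fun u => ENNReal.ofReal (1 / beta a b) *
        ENNReal.ofReal (u ^ (a - 1) * (1 - u) ^ (b - 1))) u := by
    ext u
    by_cases hu : u ∈ Set.Ioo (0 : ℝ) 1
    · have : 0 ≤ u ^ (a - 1) * (1 - u) ^ (b - 1) :=
        mul_nonneg (Real.rpow_nonneg hu.1.le _) (Real.rpow_nonneg (by linarith [hu.2]) _)
      rw [Set.indicator_of_mem hu, betaPDF_of_pos_lt_one hu.1 hu.2, mul_assoc,
        ENNReal.ofReal_mul' this]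
    · rw [Set.indicator_of_notMem hu, betaPDF_eq, if_neg (by exact hu), ENNReal.ofReal_zero]
  have hpm : Measurable (betaPDF a b) := (measurable_betaPDFReal a b).ennreal_ofReal
  rw [betaMeasure, lintegral_withDensity_eq_lintegral_mul _ hpm hf, hpdf,
    ← lintegral_const_mul' _ _ ENNReal.ofReal_ne_top, ← lintegral_indicator measurableSet_Ioo]
  refine lintegral_congr fun u => ?_
  by_cases hu : u ∈ Set.Ioo (0 : ℝ) 1
  · simp [hu, mul_assoc]
  · simp [hu]

/-- The Jacobian times the dilation factor in dimension `n + 1` is half the unnormalised Beta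
density; the half cancels the doubling in `lintegral_comp_sq`. -/
theorem ratio_jacobian_mul_scale (n : ℕ) {u : ℝ} (h0 : 0 < u) (h1 : u < 1) :
    1 / (2 * √(u / (1 - u))) / (1 - u) ^ 2 * √(1 - u) ^ (n + 2) =
      1 / 2 * (u ^ ((1 / 2 : ℝ) - 1) * (1 - u) ^ ((((n + 2 : ℕ) : ℝ) - 1) / 2 - 1)) := by
  have hv : 0 < 1 - u := by linarith
  have e1 : √(1 - u) ^ (n + 2) = (1 - u) ^ (((n : ℝ) + 2) / 2) := by
    rw [Real.sqrt_eq_rpow, ← Real.rpow_natCast, ← Real.rpow_mul hv.le]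
    push_cast; ring_nf
  have e2 : √(u / (1 - u)) = u ^ (1 / 2 : ℝ) / (1 - u) ^ (1 / 2 : ℝ) := by
    rw [Real.sqrt_eq_rpow, Real.div_rpow h0.le hv.le]
  have e3 : (1 - u) ^ ((((n + 2 : ℕ) : ℝ) - 1) / 2 - 1) =
      (1 - u) ^ (((n : ℝ) + 2) / 2) * (1 - u) ^ (1 / 2 : ℝ) / (1 - u) ^ 2 := by
    rw [← Real.rpow_natCast, ← Real.rpow_add hv, ← Real.rpow_sub hv]
    push_cast; ring_nf
  have e4 : u ^ ((1 / 2 : ℝ) - 1) = 1 / u ^ (1 / 2 : ℝ) := by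
    rw [one_div (u ^ _), ← Real.rpow_neg h0.le]; norm_num
  have p1 := Real.rpow_pos_of_pos h0 (1 / 2)
  have p2 := Real.rpow_pos_of_pos hv (1 / 2)
  rw [e1, e2, e3, e4]
  field_simp

theorem ae_sum_sq_pos (n : ℕ) : ∀ᵐ y : Fin (n + 1) → ℝ, 0 < ∑ i, y i ^ 2 := by
  have : ∀ᵐ y : Fin (n + 1) → ℝ, y ≠ 0 := by
    simp [ae_iff]
  filter_upwards [this] with y hy
  obtain ⟨i, hi⟩ := Function.ne_iff.mp hy
  exact Finset.sum_pos' (fun _ _ => sq_nonneg _) ⟨i, Finset.mem_univ _, by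
    have : y i ≠ 0 := hi
    positivity⟩

/-- With `q = |y|² > 0` and `t² = q u/(1 - u)`, one has `t² + q = q/(1 - u)`: the argument of `f`
becomes `u`, and the ball condition becomes `q < 1 - u`. After swapping integrals, the `y`-integral
depends on `u` only through a dilation by `√(1 - u)`. -/
theorem lintegral_lintegral_ball_ratio (n : ℕ) {f : ℝ → ℝ≥0∞} (hf : Measurable f) :
    ∫⁻ y : Fin (n + 1) → ℝ, ∫⁻ t : ℝ, Set.indicator (Set.Iio 1) 1 (t ^ 2 + ∑ i, y i ^ 2) *
        f (t ^ 2 / (t ^ 2 + ∑ i, y i ^ 2)) =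
      (∫⁻ y : Fin (n + 1) → ℝ, ENNReal.ofReal (√(∑ i, y i ^ 2)) *
          Set.indicator (Set.Iio 1) 1 (∑ i, y i ^ 2)) *
        ∫⁻ u in Set.Ioo (0 : ℝ) 1, ENNReal.ofReal
          (u ^ ((1 / 2 : ℝ) - 1) * (1 - u) ^ ((((n + 2 : ℕ) : ℝ) - 1) / 2 - 1)) * f u := by
  set W : ℝ → ℝ≥0∞ := fun u => ENNReal.ofReal (1 / (2 * √(u / (1 - u))) / (1 - u) ^ 2) with hW
  have hWm : Measurable W := by fun_prop
  set K := ∫⁻ y : Fin (n + 1) → ℝ, ENNReal.ofReal (√(∑ i, y i ^ 2)) *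
          Set.indicator (Set.Iio 1) 1 (∑ i, y i ^ 2) with hK
  have hind : Measurable fun p : (Fin (n + 1) → ℝ) × ℝ =>
      Set.indicator (Set.Iio (1 - p.2)) (1 : ℝ → ℝ≥0∞) (∑ i, p.1 i ^ 2) := by
    have hS : MeasurableSet {p : (Fin (n + 1) → ℝ) × ℝ | ∑ i, p.1 i ^ 2 < 1 - p.2} :=
      measurableSet_lt (by fun_prop) (by fun_prop)
    exact measurable_one.indicator hS
  have step : ∀ᵐ y : Fin (n + 1) → ℝ,
      ∫⁻ t : ℝ, Set.indicator (Set.Iio 1) 1 (t ^ 2 + ∑ i, y i ^ 2) *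
        f (t ^ 2 / (t ^ 2 + ∑ i, y i ^ 2)) =
      2 * ∫⁻ u in Set.Ioo (0 : ℝ) 1, W u * f u * (ENNReal.ofReal (√(∑ i, y i ^ 2)) *
        Set.indicator (Set.Iio (1 - u)) 1 (∑ i, y i ^ 2)) := by
    filter_upwards [ae_sum_sq_pos n] with y hy
    set q := ∑ i, y i ^ 2
    rw [lintegral_comp_sq fun x => Set.indicator (Set.Iio 1) 1 (x + q) * f (x / (x + q)),
      lintegral_Ioi_eq_lintegral_Ioo_ratio hy fun x =>
        Set.indicator (Set.Iio 1) 1 (x + q) * f (x / (x + q))]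
    congr 1
    refine setLIntegral_congr_fun measurableSet_Ioo fun u hu => ?_
    have hv : 0 < 1 - u := by linarith [hu.2]
    have e1 : q * (u / (1 - u)) + q = q / (1 - u) := by field_simp; ring
    have e2 : q * (u / (1 - u)) / (q / (1 - u)) = u := by field_simp
    have e3 : Set.indicator (Set.Iio 1) (1 : ℝ → ℝ≥0∞) (q / (1 - u)) =
        Set.indicator (Set.Iio (1 - u)) 1 q := by
      simp [Set.indicator_apply, div_lt_one hv]
    simp only [e1, e2, e3, hW]
    ring
  rw [lintegral_congr_ae step, lintegral_const_mul' _ _ ENNReal.ofNat_ne_top,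
    lintegral_lintegral_swap (by
      refine Measurable.aemeasurable ?_
      exact ((hWm.comp measurable_snd).mul (hf.comp measurable_snd)).mul
        (Measurable.mul (by fun_prop) hind))]
  rw [← lintegral_const_mul K (by fun_prop),
    ← lintegral_const_mul' (2 : ℝ≥0∞) _ ENNReal.ofNat_ne_top]
  refine setLIntegral_congr_fun measurableSet_Ioo fun u hu => ?_
  have hv : 0 < 1 - u := by linarith [hu.2]
  have hg : Measurable fun y : Fin (n + 1) → ℝ => ENNReal.ofReal (√(∑ i, y i ^ 2)) *
      Set.indicator (Set.Iio (1 - u)) (1 : ℝ → ℝ≥0∞) (∑ i, y i ^ 2) :=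
    Measurable.mul (by fun_prop) ((measurable_one.indicator measurableSet_Iio).comp (by fun_prop))
  rw [lintegral_const_mul _ hg, lintegral_sqrt_sum_sq_indicator_scale _ hv, ← hK]
  have h2 : (2 : ℝ≥0∞) * (W u * ENNReal.ofReal (√(1 - u) ^ (n + 1 + 1))) = ENNReal.ofReal
      (u ^ ((1 / 2 : ℝ) - 1) * (1 - u) ^ ((((n + 2 : ℕ) : ℝ) - 1) / 2 - 1)) := by
    rw [hW, ← ENNReal.ofReal_mul (by positivity), ratio_jacobian_mul_scale n hu.1 hu.2,
      ← ENNReal.ofReal_ofNat, ← ENNReal.ofReal_mul (by norm_num)]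
    congr 1
    ring
  rw [← h2]
  ring

/-! ### The law of a squared coordinate. -/

theorem lintegral_uniformBall_ratio (n : ℕ) {f : ℝ → ℝ≥0∞} (hf : Measurable f) :
    ∫⁻ x in Metric.ball (0 : EuclideanSpace ℝ (Fin (n + 2))) 1, f ((‖x‖⁻¹ • x) 0 ^ 2) =
      ∫⁻ y : Fin (n + 1) → ℝ, ∫⁻ t : ℝ, Set.indicator (Set.Iio 1) 1 (t ^ 2 + ∑ i, y i ^ 2) *
        f (t ^ 2 / (t ^ 2 + ∑ i, y i ^ 2)) := by
  have hm : Measurable fun p : ℝ × (Fin (n + 1) → ℝ) =>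
      Set.indicator (Set.Iio 1) (1 : ℝ → ℝ≥0∞) (p.1 ^ 2 + ∑ i, p.2 i ^ 2) *
        f (p.1 ^ 2 / (p.1 ^ 2 + ∑ i, p.2 i ^ 2)) :=
    Measurable.mul ((measurable_one.indicator measurableSet_Iio).comp (by fun_prop))
      (hf.comp (by fun_prop))
  have hmp := (volume_preserving_piFinSuccAbove (fun _ : Fin (n + 2) => ℝ) 0).comp
    (PiLp.volume_preserving_ofLp (Fin (n + 2)))
  rw [← lintegral_prod_symm _ hm.aemeasurable, ← Measure.volume_eq_prod, ← hmp.lintegral_comp hm,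
    ← lintegral_indicator measurableSet_ball]
  refine lintegral_congr fun x => ?_
  have hn : ‖x‖ ^ 2 = x 0 ^ 2 + ∑ i : Fin (n + 1), x i.succ ^ 2 := by
    rw [EuclideanSpace.real_norm_sq_eq, Fin.sum_univ_succ]
  -- At `x = 0` both sides take the default value `0`.
  have hsm : (‖x‖⁻¹ • x) 0 ^ 2 = x 0 ^ 2 / ‖x‖ ^ 2 := by
    simp [mul_pow, div_eq_inv_mul]
  have hb : x ∈ Metric.ball (0 : EuclideanSpace ℝ (Fin (n + 2))) 1 ↔ ‖x‖ ^ 2 < 1 := by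
    rw [mem_ball_zero_iff, sq_lt_one_iff₀ (norm_nonneg _)]
  have hfst : (MeasurableEquiv.piFinSuccAbove (fun _ : Fin (n + 2) => ℝ) 0 x.ofLp).1 = x 0 := rfl
  have hsnd : ∀ i, (MeasurableEquiv.piFinSuccAbove (fun _ : Fin (n + 2) => ℝ) 0 x.ofLp).2 i
      = x i.succ := fun i => rfl
  simp only [Function.comp_apply, hfst, hsnd, ← hn]
  by_cases h : ‖x‖ ^ 2 < 1
  · rw [Set.indicator_of_mem (hb.mpr h), Set.indicator_of_mem (Set.mem_Iio.mpr h), hsm,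
      Pi.one_apply, one_mul]
  · rw [Set.indicator_of_notMem (mt hb.mp h), Set.indicator_of_notMem (mt Set.mem_Iio.mp h), zero_mul]

theorem map_sq_uniformSphere (n : ℕ) :
    (uniformSphere (n + 2)).map (fun x => x 0 ^ 2) =
      betaMeasure (1 / 2) ((((n + 2 : ℕ) : ℝ) - 1) / 2) := by
  have hb : 0 < (((n + 2 : ℕ) : ℝ) - 1) / 2 := by
    push_cast
    have : (0 : ℝ) ≤ n := n.cast_nonneg
    linarith
  set b := (((n + 2 : ℕ) : ℝ) - 1) / 2 with hbdef
  have := isProbabilityMeasure_uniformSphere (n + 2)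
  have := isProbabilityMeasureBeta (by norm_num : (0 : ℝ) < 1 / 2) hb
  have hm : Measurable fun x : EuclideanSpace ℝ (Fin (n + 2)) => x 0 ^ 2 := by fun_prop
  have := Measure.isProbabilityMeasure_map (μ := uniformSphere (n + 2)) hm.aemeasurable
  have hB0 : ENNReal.ofReal (1 / beta (1 / 2) b) ≠ 0 := by
    have := beta_pos (by norm_num : (0 : ℝ) < 1 / 2) hb
    simpa using this
  obtain ⟨C, hC⟩ : ∃ C : ℝ≥0∞, (uniformSphere (n + 2)).map (fun x => x 0 ^ 2) =
      C • betaMeasure (1 / 2) b := by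
    -- The constant is never evaluated: both laws have mass one, which forces `C = 1`.
    refine ⟨(((volume : Measure (EuclideanSpace ℝ (Fin (n + 2)))).toSphere Set.univ)⁻¹ *
      (n + 2 : ℕ)) * ((∫⁻ y : Fin (n + 1) → ℝ, ENNReal.ofReal (√(∑ i, y i ^ 2)) *
          Set.indicator (Set.Iio 1) 1 (∑ i, y i ^ 2)) *
        (ENNReal.ofReal (1 / beta (1 / 2) b))⁻¹), ?_⟩
    ext A hA
    have hf : Measurable (Set.indicator A (1 : ℝ → ℝ≥0∞)) := measurable_one.indicator hA
    rw [Measure.smul_apply, ← lintegral_indicator_one hA, ← lintegral_indicator_one hA,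
      lintegral_map hf hm, uniformSphere_eq_map_normalize, lintegral_smul_measure,
      lintegral_map (f := fun x : EuclideanSpace ℝ (Fin (n + 2)) => A.indicator 1 (x 0 ^ 2))
        (hf.comp hm) (by fun_prop), lintegral_uniformBall_ratio n hf,
      lintegral_lintegral_ball_ratio n hf, betaMeasure_lintegral _ _ hf, smul_eq_mul, smul_eq_mul,
      ← hbdef]
    simp only [mul_assoc]
    rw [← mul_assoc (ENNReal.ofReal (1 / beta (1 / 2) b))⁻¹,
      ENNReal.inv_mul_cancel hB0 ENNReal.ofReal_ne_top, one_mul]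
  have h1 := congrArg (fun μ : Measure ℝ => μ Set.univ) hC
  simp only [measure_univ, Measure.smul_apply, smul_eq_mul, mul_one] at h1
  rw [hC, ← h1, one_smul]

/-! ### Spectral coordinates and the main theorem. -/

/-- The transpose of an orthogonal matrix, as a linear isometry of Euclidean space. -/
noncomputable def transposeIsometryEquiv {d : ℕ} {U : Matrix (Fin d) (Fin d) ℝ}
    (hU : U ∈ Matrix.orthogonalGroup (Fin d) ℝ) :
    EuclideanSpace ℝ (Fin d) ≃ₗᵢ[ℝ] EuclideanSpace ℝ (Fin d) :=
  LinearIsometry.toLinearIsometryEquiv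
    { toLinearMap := Matrix.toEuclideanLin Uᵀ
      norm_map' := fun x => by
        have hUU : U * Uᵀ = 1 := by
          simpa [Matrix.star_eq_conjTranspose] using (Matrix.mem_orthogonalGroup_iff _ _).mp hU
        rw [← sq_eq_sq₀ (norm_nonneg _) (norm_nonneg _), EuclideanSpace.real_norm_sq_eq,
          EuclideanSpace.real_norm_sq_eq]
        have h : (Uᵀ *ᵥ x.ofLp) ⬝ᵥ (Uᵀ *ᵥ x.ofLp) = x.ofLp ⬝ᵥ x.ofLp := by
          rw [Matrix.dotProduct_mulVec, Matrix.vecMul_transpose, Matrix.mulVec_mulVec, hUU,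
            Matrix.one_mulVec]
        simpa [dotProduct, sq] using h } rfl

theorem quadForm_conj_diagonal {d : ℕ} (U : Matrix (Fin d) (Fin d) ℝ) (lam : Fin d → ℝ)
    (x : EuclideanSpace ℝ (Fin d)) :
    quadForm (U * Matrix.diagonal lam * Uᵀ) x = ∑ i, lam i * (Uᵀ *ᵥ x.ofLp) i ^ 2 := by
  rw [quadForm, ← Matrix.mulVec_mulVec, ← Matrix.mulVec_mulVec, Matrix.dotProduct_mulVec,
    ← Matrix.mulVec_transpose]
  simp only [dotProduct, Matrix.mulVec_diagonal]
  exact Finset.sum_congr rfl fun i _ => by ring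

theorem quadForm_smul {d : ℕ} (G : Matrix (Fin d) (Fin d) ℝ) (m : ℝ)
    (x : EuclideanSpace ℝ (Fin d)) : quadForm G (m • x) = m ^ 2 * quadForm G x := by
  simp only [quadForm, WithLp.ofLp_smul, Matrix.mulVec_smul, dotProduct_smul, smul_dotProduct,
    smul_eq_mul]
  ring

theorem eigenvalue_nonneg_of_posSemidef {d : ℕ} {U : Matrix (Fin d) (Fin d) ℝ} {lam : Fin d → ℝ}
    (hU : U ∈ Matrix.orthogonalGroup (Fin d) ℝ)
    (hG : (U * Matrix.diagonal lam * Uᵀ).PosSemidef) (i : Fin d) : 0 ≤ lam i := by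
  have hUU : Uᵀ * U = 1 := by
    simpa [Matrix.star_eq_conjTranspose] using (Matrix.mem_orthogonalGroup_iff' _ _).mp hU
  have h := hG.conjTranspose_mul_mul_same U
  rw [Matrix.conjTranspose_eq_transpose_of_trivial,
    show Uᵀ * (U * Matrix.diagonal lam * Uᵀ) * U = (Uᵀ * U) * Matrix.diagonal lam * (Uᵀ * U) by
      simp only [Matrix.mul_assoc], hUU, Matrix.one_mul, Matrix.mul_one] at h
  simpa using h.diag_nonneg (i := i)

theorem sum_mul_sq_bounds {n : ℕ} {lam : Fin (n + 2) → ℝ} (hlam : Antitone lam)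
    (h0 : ∀ i, 0 ≤ lam i) {y : Fin (n + 2) → ℝ} (hy : ∑ i, y i ^ 2 = 1) :
    lam 0 * y 0 ^ 2 ≤ ∑ i, lam i * y i ^ 2 ∧
      ∑ i, lam i * y i ^ 2 ≤ lam 0 * y 0 ^ 2 + lam 1 * (1 - y 0 ^ 2) := by
  rw [Fin.sum_univ_succ] at hy
  rw [Fin.sum_univ_succ, ← hy, add_sub_cancel_left, Finset.mul_sum]
  refine ⟨le_add_of_nonneg_right (Finset.sum_nonneg fun i _ => mul_nonneg (h0 _) (sq_nonneg _)),
    add_le_add_right (Finset.sum_le_sum fun i _ =>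
      mul_le_mul_of_nonneg_right (hlam ?_) (sq_nonneg _)) _⟩
  rw [← Fin.succ_zero_eq_one]
  exact Fin.succ_le_succ_iff.mpr (Fin.zero_le i)

theorem corollary1 {d : ℕ} (hd : 2 ≤ d)
    (G U : Matrix (Fin d) (Fin d) ℝ) (lam : Fin d → ℝ)
    (hG : G.PosSemidef)
    (hU : U ∈ Matrix.orthogonalGroup (Fin d) ℝ)
    (hlam : Antitone lam)
    (hGU : G = U * Matrix.diagonal lam * Uᵀ)
    {Ω : Type*} [MeasurableSpace Ω] (P : Measure Ω) [IsProbabilityMeasure P]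
    (s c Y : Ω → EuclideanSpace ℝ (Fin d))
    (hs : HasLaw s (uniformSphere d) P)
    (m : ℝ) (hm : 0 < m)
    (hc : ∀ ω, c ω = m • s ω)
    (hY : ∀ ω, Y ω = WithLp.toLp 2 (Uᵀ *ᵥ (s ω).ofLp)) :
    -- the quadratic form in spectral coordinates
    (∀ ω, quadForm G (c ω) = m ^ 2 * ∑ i, lam i * (Y ω i) ^ 2) ∧
    -- the rotated direction is again uniform on the sphere
    HasLaw Y (uniformSphere d) P ∧
    -- the law of the squared first coordinate
    HasLaw (fun ω => (Y ω ⟨0, by omega⟩) ^ 2) (betaMeasure (1 / 2) (((d : ℝ) - 1) / 2)) P ∧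
    -- the sandwich, at every sample point at which `s` lies on the sphere, hence almost surely
    (∀ᵐ ω ∂P, ‖s ω‖ = 1) ∧
    (∀ ω, ‖s ω‖ = 1 →
      ‖c ω‖ = m ∧
      m ^ 2 * (lam ⟨0, by omega⟩ * (Y ω ⟨0, by omega⟩) ^ 2) ≤ quadForm G (c ω) ∧
      quadForm G (c ω) ≤
        m ^ 2 * (lam ⟨0, by omega⟩ * (Y ω ⟨0, by omega⟩) ^ 2 +
          lam ⟨1, by omega⟩ * (1 - (Y ω ⟨0, by omega⟩) ^ 2))) ∧
    -- approximation in distribution by the Beta law when `lam 1` is small relative to `lam 0`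
    (0 < lam ⟨0, by omega⟩ →
      levyProkhorovEDist
          (P.map (fun ω => quadForm G (c ω) / (lam ⟨0, by omega⟩ * ‖c ω‖ ^ 2)))
          (betaMeasure (1 / 2) (((d : ℝ) - 1) / 2)) ≤
        ENNReal.ofReal (lam ⟨1, by omega⟩ / lam ⟨0, by omega⟩)) := by
  obtain ⟨n, rfl⟩ := Nat.exists_eq_add_of_le' hd
  have hz : (⟨0, by omega⟩ : Fin (n + 2)) = 0 := rfl
  have ho : (⟨1, by omega⟩ : Fin (n + 2)) = 1 := rfl
  simp only [hz, ho]
  subst hGU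
  have h0 := eigenvalue_nonneg_of_posSemidef hU hG
  have hYL : Y = transposeIsometryEquiv hU ∘ s := funext fun ω => hY ω
  have hquad : ∀ ω, quadForm (U * Matrix.diagonal lam * Uᵀ) (c ω) =
      m ^ 2 * ∑ i, lam i * (Y ω i) ^ 2 := fun ω => by
    rw [hc, quadForm_smul, quadForm_conj_diagonal, hY]
  have hYlaw : HasLaw Y (uniformSphere (n + 2)) P := by
    rw [hYL]
    exact (measurePreserving_uniformSphere (n + 2) (transposeIsometryEquiv hU)).hasLaw.comp hs
  have hBlaw : HasLaw (fun ω => Y ω 0 ^ 2)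
      (betaMeasure (1 / 2) ((((n + 2 : ℕ) : ℝ) - 1) / 2)) P :=
    have hsq : HasLaw (fun x : EuclideanSpace ℝ (Fin (n + 2)) => x 0 ^ 2)
        (betaMeasure (1 / 2) ((((n + 2 : ℕ) : ℝ) - 1) / 2)) (uniformSphere (n + 2)) :=
      ⟨by fun_prop, map_sq_uniformSphere n⟩
    hsq.comp hYlaw
  have hnorm : ∀ᵐ ω ∂P, ‖s ω‖ = 1 :=
    ae_of_ae_map hs.aemeasurable (hs.map_eq ▸ ae_norm_eq_one_uniformSphere (n + 2))
  have hYsum : ∀ ω, ‖s ω‖ = 1 → ∑ i, Y ω i ^ 2 = 1 := fun ω hω => by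
    rw [← EuclideanSpace.real_norm_sq_eq, hYL, Function.comp_apply,
      LinearIsometryEquiv.norm_map, hω, one_pow]
  have hcnorm : ∀ ω, ‖s ω‖ = 1 → ‖c ω‖ = m := fun ω hω => by
    rw [hc, norm_smul, hω, mul_one, Real.norm_of_nonneg hm.le]
  refine ⟨hquad, hYlaw, hBlaw, hnorm, fun ω hω => ?_, fun hpos => ?_⟩
  · obtain ⟨h1, h2⟩ := sum_mul_sq_bounds hlam h0 (hYsum ω hω)
    rw [hquad]
    exact ⟨hcnorm ω hω, mul_le_mul_of_nonneg_left h1 (sq_nonneg m),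
      mul_le_mul_of_nonneg_left h2 (sq_nonneg m)⟩
  · rw [← hBlaw.map_eq]
    have hYm : AEMeasurable Y P := hYlaw.aemeasurable
    have hcm : AEMeasurable c P := by
      rw [show c = fun ω => m • s ω from funext hc]
      exact hs.aemeasurable.const_smul m
    refine levyProkhorovEDist_map_le P ?_ hBlaw.aemeasurable ?_
    · simp only [hquad]
      fun_prop
    · filter_upwards [hnorm] with ω hω
      obtain ⟨h1, h2⟩ := sum_mul_sq_bounds hlam h0 (hYsum ω hω)
      have hm2 : m ^ 2 ≠ 0 := by positivity
      rw [hquad, hcnorm ω hω, mul_comm (lam 0), mul_div_mul_left _ _ hm2,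
        show (∑ i, lam i * Y ω i ^ 2) / lam 0 - Y ω 0 ^ 2 =
          ((∑ i, lam i * Y ω i ^ 2) - lam 0 * Y ω 0 ^ 2) / lam 0 by field_simp,
        abs_of_nonneg (div_nonneg (sub_nonneg.mpr h1) hpos.le)]
      refine div_le_div_of_nonneg_right ?_ hpos.le
      -- The gap is at most `lam 1 * (1 - Y₁²)`, hence at most `lam 1`.
      nlinarith [mul_nonneg (h0 1) (sq_nonneg (Y ω 0))]
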